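/- Let $c,d$ be positive integers, let $G=\mathrm{BS}(c,d)=\langle a,b: ab^c=b^da\rangle$, let $P$ be the submonoid of $G$ generated by $a$ and $b$, and order $G$ by $g\le h\iff g^{-1}h\in P$. For $x,y\in P$ with a common upper bound in $P$, let $x\vee y$ be their least upper bound; otherwise write $x\vee y=\infty$. Let $C^*(G,P)$ be the universal unital $C^*$-algebra generated by a Nica-covariant representation $T$ of $P$, that is, isometries $T_x$ ($x\in P$) with $T_e=1$, $T_xT_y=T_{xy}$, and $T_xT_x^*T_yT_y^*=T_{x\vee y}T_{x\vee y}^*$ if $x\vee y<\infty$ and $=0$ if $x\vee y=\infty$. Let $\theta:G\to\mathbb Z$ be the homomorphism with $\theta(a)=1$, $\theta(b)=0$, and let $\alpha$ be the action of $\mathbb R$ on $C^*(G,P)$ with $\alpha_t(T_x)=e^{it\theta(x)}T_x$. For $\beta\in\mathbb R$, a KMS$_\beta$ state of $(C^*(G,P),\alpha)$ is a state $\psi$ with $\psi(xy)=\psi(y\,\alpha_{i\beta}(x))$ for all $\alpha$-analytic $x,y$ (those $x$ for which $t\mapsto\alpha_t(x)$ extends to an entire function $z\mapsto\alpha_z(x)$).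 A state factors through the quotient by a closed two-sided ideal if it is the composition of the quotient map with a state of the quotient. Let $\beta\in\mathbb R$. Then: 1. Every KMS$_\beta$ state of $(C^*(G,P),\alpha)$ factors through the quotient of $C^*(G,P)$ by the closed two-sided ideal generated by $1-T_bT_b^*$. 2. If $\beta<\ln d$, then $(C^*(G,P),\alpha)$ has no KMS$_\beta$ states. 3. Let $I$ be the closed two-sided ideal generated by $1-\sum_{j=0}^{d-1}T_{b^ja}T_{b^ja}^*$, and let $\mathcal O(G,P)=C^*(G,P)/I$. A KMS$_\beta$ state of $(C^*(G,P),\alpha)$ factors through $\mathcal O(G,P)$ if and only if $\beta=\ln d$. -/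

import Mathlib

open scoped ENNReal ComplexOrder

universe u

noncomputable section

namespace BaumslagSolitar

/-! ### The group `BS(c, d)`, its positive monoid, and the height -/

/-- The two generators `a`, `b`. -/
inductive Gen : Type
  | a
  | b

/-- The single relator of `⟨a, b : a b ^ c = b ^ d a⟩`. -/
def relators (c d : ℕ) : Set (FreeGroup Gen) :=
  {FreeGroup.of Gen.a * FreeGroup.of Gen.b ^ c *
    (FreeGroup.of Gen.b ^ d * FreeGroup.of Gen.a)⁻¹}

/-- The Baumslag-Solitar group `BS(c, d) = ⟨a, b : a b ^ c = b ^ d a⟩`. -/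
abbrev BS (c d : ℕ) : Type := PresentedGroup (relators c d)

/-- The generator `a` of the group. -/
def genA (c d : ℕ) : BS c d := PresentedGroup.of Gen.a

/-- The generator `b` of the group. -/
def genB (c d : ℕ) : BS c d := PresentedGroup.of Gen.b

/-- The submonoid `P` of `BS(c, d)` generated by `a` and `b`. -/
def posMonoid (c d : ℕ) : Submonoid (BS c d) := Submonoid.closure {genA c d, genB c d}

/-- The element `a` of `P`. -/
def posA (c d : ℕ) : posMonoid c d :=
  ⟨genA c d, Submonoid.subset_closure (Set.mem_insert _ _)⟩

/-- The element `b` of `P`. -/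
def posB (c d : ℕ) : posMonoid c d :=
  ⟨genB c d, Submonoid.subset_closure (Set.mem_insert_of_mem _ rfl)⟩

/-- The height on generators: `θ(a) = 1`, `θ(b) = 0`. -/
def genHeight : Gen → Multiplicative ℤ
  | Gen.a => Multiplicative.ofAdd 1
  | Gen.b => 1

theorem genHeight_relators (c d : ℕ) :
    ∀ r ∈ relators c d, FreeGroup.lift genHeight r = 1 := by
  intro r hr
  rw [relators, Set.mem_singleton_iff] at hr
  subst hr
  simp [genHeight]

/-- The height homomorphism `θ : BS(c, d) → ℤ` with `θ(a) = 1` and `θ(b) = 0`. -/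
def heightHom (c d : ℕ) : BS c d →* Multiplicative ℤ :=
  PresentedGroup.toGroup (genHeight_relators c d)

/-- The height `θ(g)` as an integer. -/
def height {c d : ℕ} (g : BS c d) : ℤ := Multiplicative.toAdd (heightHom c d g)

/-- The left-invariant order `g ≤ h ↔ g⁻¹ h ∈ P` on `BS(c, d)`. -/
def le {c d : ℕ} (g h : BS c d) : Prop := g⁻¹ * h ∈ posMonoid c d

/-- `z` is a common upper bound of `x` and `y`. -/
def IsUpperBound {c d : ℕ} (x y z : posMonoid c d) : Prop :=
  le (x : BS c d) z ∧ le (y : BS c d) z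

/-- `z = x ∨ y`: the least upper bound of `x` and `y` in `P`. -/
def IsJoin {c d : ℕ} (x y z : posMonoid c d) : Prop :=
  IsUpperBound x y z ∧ ∀ w : posMonoid c d, IsUpperBound x y w → le (z : BS c d) w

/-! ### Nica-covariant representations and the universal C*-algebra `C*(G, P)` -/

/-- A monoid homomorphism of `P` into a C*-algebra is a Nica-covariant isometric representation:
each `S x` is an isometry, and `S x (S x)* S y (S y)*` is `S (x ∨ y) (S (x ∨ y))*` if
`x ∨ y < ∞`, and `0` if `x`, `y` have no common upper bound in `P`. -/
structure IsNicaCovariant {c d : ℕ} {B : Type*} [CStarAlgebra B] (S : posMonoid c d →* B) :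
    Prop where
  isometry : ∀ x, star (S x) * S x = 1
  join : ∀ x y z, IsJoin x y z → S x * star (S x) * (S y * star (S y)) = S z * star (S z)
  no_join : ∀ x y, (¬ ∃ z, IsUpperBound x y z) → S x * star (S x) * (S y * star (S y)) = 0

/-- A Nica-covariant representation of `P` in some nonzero unital C*-algebra. -/
structure NicaRep (c d : ℕ) : Type (u + 1) where
  carrier : Type u
  [cstar : CStarAlgebra carrier]
  [nontriv : Nontrivial carrier]
  rep : posMonoid c d →* carrier
  nica : IsNicaCovariant rep

instance (c d : ℕ) (ρ : NicaRep.{u} c d) : CStarAlgebra ρ.carrier := ρ.cstar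
instance (c d : ℕ) (ρ : NicaRep.{u} c d) : Nontrivial ρ.carrier := ρ.nontriv

/-- The C*-algebra of bounded families indexed by all Nica-covariant representations. -/
abbrev Ambient (c d : ℕ) : Type (u + 1) :=
  lp (fun ρ : NicaRep.{u} c d => ρ.carrier) ∞

instance (c d : ℕ) : CStarAlgebra (Ambient.{u} c d) where

theorem norm_rep_le {c d : ℕ} (ρ : NicaRep.{u} c d) (x : posMonoid c d) : ‖ρ.rep x‖ ≤ 1 := by
  have h := CStarRing.norm_star_mul_self (x := ρ.rep x)
  rw [ρ.nica.isometry x, CStarRing.norm_one] at h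
  nlinarith [norm_nonneg (ρ.rep x)]

/-- The direct sum of all Nica-covariant representations. -/
def ambientRep (c d : ℕ) : posMonoid c d →* Ambient.{u} c d where
  toFun x := ⟨fun ρ => ρ.rep x, memℓp_infty ⟨1, by rintro _ ⟨ρ, rfl⟩; exact norm_rep_le ρ x⟩⟩
  map_one' := by ext ρ; exact map_one ρ.rep
  map_mul' x y := by ext ρ; exact map_mul ρ.rep x y

/-- `C*(G, P)` as a closed *-subalgebra: it is generated by the direct sum of all Nica-covariant
representations. -/
def universalSubalgebra (c d : ℕ) : StarSubalgebra ℂ (Ambient.{u} c d) :=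
  (StarAlgebra.adjoin ℂ (Set.range (ambientRep.{u} c d))).topologicalClosure

instance (c d : ℕ) : IsClosed (universalSubalgebra.{u} c d : Set (Ambient.{u} c d)) :=
  StarSubalgebra.isClosed_topologicalClosure _

/-- The universal C*-algebra `C*(G, P)` for Nica-covariant representations of `P`. Since `P` is
countable, its representations generate C*-algebras of cardinality at most the continuum, so every
universe `u` gives the same algebra up to isomorphism. -/
abbrev CStarGP (c d : ℕ) : Type (u + 1) := universalSubalgebra.{u} c d

theorem ambientRep_mem (c d : ℕ) (x : posMonoid c d) :
    ambientRep.{u} c d x ∈ universalSubalgebra.{u} c d :=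
  StarSubalgebra.le_topologicalClosure _ (StarAlgebra.subset_adjoin ℂ _ ⟨x, rfl⟩)

/-- The universal Nica-covariant representation `x ↦ T_x` of `P` in `C*(G, P)`. -/
def T (c d : ℕ) : posMonoid c d →* CStarGP.{u} c d where
  toFun x := ⟨ambientRep c d x, ambientRep_mem c d x⟩
  map_one' := Subtype.ext (map_one _)
  map_mul' x y := Subtype.ext (map_mul _ x y)

theorem T_isNicaCovariant (c d : ℕ) : IsNicaCovariant (T.{u} c d) where
  isometry x := by
    apply Subtype.ext; apply lp.ext; funext ρ; exact ρ.nica.isometry x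
  join x y z h := by
    apply Subtype.ext; apply lp.ext; funext ρ; exact ρ.nica.join x y z h
  no_join x y h := by
    apply Subtype.ext; apply lp.ext; funext ρ; exact ρ.nica.no_join x y h

/-- The universal property: each Nica-covariant representation `S` is `π ∘ T` for a
*-homomorphism `π` of `C*(G, P)`. -/
theorem exists_lift {c d : ℕ} {B : Type u} [CStarAlgebra B] [Nontrivial B]
    (S : posMonoid c d →* B) (hS : IsNicaCovariant S) :
    ∃ π : CStarGP.{u} c d →⋆ₐ[ℂ] B, ∀ x, π (T c d x) = S x := by
  let ρ : NicaRep.{u} c d := ⟨B, S, hS⟩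
  refine ⟨{ toFun := fun f => (f : Ambient c d) ρ
            map_one' := rfl
            map_mul' := fun _ _ => rfl
            map_zero' := rfl
            map_add' := fun _ _ => rfl
            commutes' := fun _ => rfl
            map_star' := fun _ => rfl }, fun x => rfl⟩

/-! ### The gauge action and the dynamics -/

/-- The representation `x ↦ z ^ θ(x) S x` obtained from a Nica-covariant `S` and `|z| = 1`. -/
def NicaRep.twist {c d : ℕ} (z : Circle) (ρ : NicaRep.{u} c d) : NicaRep.{u} c d where
  carrier := ρ.carrier
  rep :=
    { toFun := fun x => ((z ^ height (x : BS c d) : Circle) : ℂ) • ρ.rep x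
      map_one' := by simp [height]
      map_mul' := fun x y => by
        simp [height, zpow_add, smul_smul, mul_comm] }
  nica :=
    have key : ∀ x : posMonoid c d,
        (((z ^ height (x : BS c d) : Circle) : ℂ) • ρ.rep x) *
          star (((z ^ height (x : BS c d) : Circle) : ℂ) • ρ.rep x) =
        ρ.rep x * star (ρ.rep x) := fun x => by
      rw [star_smul, smul_mul_smul_comm, Complex.star_def, Complex.mul_conj, Circle.normSq_coe]
      simp
    { isometry := fun x => by
        change star (((z ^ height (x : BS c d) : Circle) : ℂ) • ρ.rep x) *
          (((z ^ height (x : BS c d) : Circle) : ℂ) • ρ.rep x) = 1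
        rw [star_smul, smul_mul_smul_comm, mul_comm, Complex.star_def, Complex.mul_conj,
          Circle.normSq_coe, ρ.nica.isometry]
        simp
      join := fun x y w h => by
        simp only [MonoidHom.coe_mk, OneHom.coe_mk, key]
        exact ρ.nica.join x y w h
      no_join := fun x y h => by
        simp only [MonoidHom.coe_mk, OneHom.coe_mk, key]
        exact ρ.nica.no_join x y h }

/-- The gauge automorphism on bounded families: the `ρ`-coordinate of the image of `f` is the
coordinate of `f` at the twist of `ρ` by `z`. -/
def ambientGauge (c d : ℕ) (z : Circle) : Ambient.{u} c d →⋆ₐ[ℂ] Ambient.{u} c d where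
  toFun f := ⟨fun ρ => f (ρ.twist z), memℓp_infty ⟨‖f‖, by
    rintro _ ⟨ρ, rfl⟩
    exact lp.norm_apply_le_norm ENNReal.top_ne_zero f (ρ.twist z)⟩⟩
  map_one' := rfl
  map_mul' _ _ := rfl
  map_zero' := rfl
  map_add' _ _ := rfl
  commutes' _ := rfl
  map_star' _ := rfl

theorem ambientGauge_rep (c d : ℕ) (z : Circle) (x : posMonoid c d) :
    ambientGauge.{u} c d z (ambientRep c d x) =
      ((z ^ height (x : BS c d) : Circle) : ℂ) • ambientRep c d x := rfl

theorem ambientGauge_continuous (c d : ℕ) (z : Circle) :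
    Continuous (ambientGauge.{u} c d z) :=
  AddMonoidHomClass.continuous_of_bound (ambientGauge.{u} c d z) 1 fun f => by
    rw [one_mul]
    exact lp.norm_le_of_forall_le (norm_nonneg f) fun ρ =>
      lp.norm_apply_le_norm ENNReal.top_ne_zero f (ρ.twist z)

theorem ambientGauge_mem (c d : ℕ) (z : Circle) (f : Ambient.{u} c d)
    (hf : f ∈ universalSubalgebra.{u} c d) :
    ambientGauge c d z f ∈ universalSubalgebra.{u} c d := by
  have h : universalSubalgebra.{u} c d ≤
      (universalSubalgebra.{u} c d).comap (ambientGauge c d z) := by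
    refine StarSubalgebra.topologicalClosure_minimal (StarAlgebra.adjoin_le ?_) ?_
    · rintro _ ⟨x, rfl⟩
      change ambientGauge c d z (ambientRep c d x) ∈ universalSubalgebra c d
      rw [ambientGauge_rep]
      exact (universalSubalgebra c d).smul_mem (ambientRep_mem c d x) _
    · exact (StarSubalgebra.isClosed_topologicalClosure _).preimage (ambientGauge_continuous c d z)
  exact h hf

/-- The gauge action `γ_z` on `C*(G, P)`. -/
def gauge (c d : ℕ) (z : Circle) : CStarGP.{u} c d →⋆ₐ[ℂ] CStarGP.{u} c d :=
  ((ambientGauge c d z).comp (universalSubalgebra c d).subtype).codRestrict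
    (universalSubalgebra c d) fun f => ambientGauge_mem c d z f f.2

/-- `γ_z (T_x) = z ^ θ(x) T_x`. -/
theorem gauge_T (c d : ℕ) (z : Circle) (x : posMonoid c d) :
    gauge.{u} c d z (T c d x) = ((z ^ height (x : BS c d) : Circle) : ℂ) • T c d x := rfl

theorem gauge_continuous (c d : ℕ) (z : Circle) : Continuous (gauge.{u} c d z) :=
  ((ambientGauge_continuous c d z).comp continuous_subtype_val).subtype_mk _

/-- `γ` is an action: `γ_z γ_w = γ_{zw}`. -/
theorem gauge_mul (c d : ℕ) (z w : Circle) :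
    (gauge.{u} c d z).comp (gauge c d w) = gauge c d (z * w) := by
  have h1 : Continuous ((gauge.{u} c d z).comp (gauge c d w)) :=
    (gauge_continuous c d z).comp (gauge_continuous c d w)
  refine StarAlgHom.ext_topologicalClosure h1 (gauge_continuous c d (z * w)) ?_
  refine StarAlgHom.ext_adjoin ?_
  rintro ⟨_, _⟩ ⟨x, rfl⟩
  change gauge c d z (gauge c d w (T c d x)) = gauge c d (z * w) (T c d x)
  simp only [gauge_T, map_smul, smul_smul, mul_zpow, Circle.coe_mul, mul_comm]

/-- The dynamics `α_t = γ_{exp(it)}` on `C*(G, P)`. -/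
def dynamics (c d : ℕ) (t : ℝ) : CStarGP.{u} c d →⋆ₐ[ℂ] CStarGP.{u} c d :=
  gauge c d (Circle.exp t)

/-! ### States, KMS states, and quotients -/

/-- A state: a bounded linear functional which is positive and takes the value `1` at `1`. -/
structure IsState {B : Type*} [Ring B] [StarRing B] [TopologicalSpace B] [Module ℂ B]
    (φ : B →L[ℂ] ℂ) : Prop where
  nonneg : ∀ x : B, 0 ≤ φ (star x * x)
  map_one : φ 1 = 1

/-- `F` is an entire extension of the orbit `t ↦ α_t(x)`; then `F z` is what is written
`α_z(x)`. -/
def IsEntireOrbit {c d : ℕ} (x : CStarGP.{u} c d) (F : ℂ → CStarGP.{u} c d) : Prop :=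
  Differentiable ℂ F ∧ ∀ t : ℝ, F t = dynamics c d t x

/-- KMS states at inverse temperature `β`: states `ψ` with `ψ(x y) = ψ(y α_{iβ}(x))` for all
analytic elements `x`, `y`. -/
structure IsKMS {c d : ℕ} (β : ℝ) (ψ : CStarGP.{u} c d →L[ℂ] ℂ) : Prop where
  isState : IsState ψ
  kms : ∀ (x y : CStarGP.{u} c d) (F K : ℂ → CStarGP.{u} c d),
    IsEntireOrbit x F → IsEntireOrbit y K → ψ (x * y) = ψ (y * F (Complex.I * β))

section Quotient

variable {A : Type*} [CStarAlgebra A]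

/-- The closed two-sided ideal generated by a self-adjoint element `p`. -/
def closedIdeal (p : selfAdjoint A) : Ideal A :=
  sInf {J : Ideal A | J.IsTwoSided ∧ IsClosed (J : Set A) ∧ (p : A) ∈ J}

theorem mem_closedIdeal {p : selfAdjoint A} {x : A} :
    x ∈ closedIdeal p ↔
      ∀ J : Ideal A, J.IsTwoSided → IsClosed (J : Set A) → (p : A) ∈ J → x ∈ J := by
  simp only [closedIdeal, Submodule.mem_sInf, Set.mem_ofPred_eq]
  exact ⟨fun h J h1 h2 h3 => h J ⟨h1, h2, h3⟩, fun h J hJ => h J hJ.1 hJ.2.1 hJ.2.2⟩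

instance (p : selfAdjoint A) : (closedIdeal p).IsTwoSided where
  mul_mem_of_left y hx := mem_closedIdeal.2 fun J h1 h2 h3 =>
    h1.mul_mem_of_left y (mem_closedIdeal.1 hx J h1 h2 h3)

theorem star_mem_closedIdeal {p : selfAdjoint A} {x : A} (hx : x ∈ closedIdeal p) :
    star x ∈ closedIdeal p := by
  refine mem_closedIdeal.2 fun J h1 h2 h3 => ?_
  let J' : Ideal A :=
    { carrier := {y | star y ∈ J}
      add_mem' := fun {y z} hy hz => by
        simpa only [Set.mem_ofPred_eq, star_add] using J.add_mem hy hz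
      zero_mem' := by simp
      smul_mem' := fun y z hz => by
        simpa only [smul_eq_mul, Set.mem_ofPred_eq, star_mul] using h1.mul_mem_of_left _ hz }
  refine mem_closedIdeal.1 hx J' ⟨fun {y} z hy => ?_⟩ (h2.preimage continuous_star) ?_
  · change star (y * z) ∈ J
    rw [star_mul]
    exact J.mul_mem_left _ hy
  · change star (p : A) ∈ J
    rw [p.2.star_eq]
    exact h3

/-- The quotient C*-algebra by the closed two-sided ideal generated by `p`. -/
abbrev IdealQuotient (p : selfAdjoint A) : Type _ := A ⧸ closedIdeal p

/-- The involution `star (x + I) = star x + I` on the quotient. -/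
instance (p : selfAdjoint A) : StarRing (IdealQuotient p) where
  star := Quotient.map' star fun x y h => by
    rw [Submodule.quotientRel_def] at h ⊢
    rw [← star_sub]
    exact star_mem_closedIdeal h
  star_involutive x := by
    obtain ⟨x, rfl⟩ := Ideal.Quotient.mk_surjective x
    exact congrArg (Ideal.Quotient.mk (closedIdeal p)) (star_star x)
  star_mul x y := by
    obtain ⟨x, rfl⟩ := Ideal.Quotient.mk_surjective x
    obtain ⟨y, rfl⟩ := Ideal.Quotient.mk_surjective y
    exact congrArg (Ideal.Quotient.mk (closedIdeal p)) (star_mul x y)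
  star_add x y := by
    obtain ⟨x, rfl⟩ := Ideal.Quotient.mk_surjective x
    obtain ⟨y, rfl⟩ := Ideal.Quotient.mk_surjective y
    exact congrArg (Ideal.Quotient.mk (closedIdeal p)) (star_add x y)

/-- `ψ` factors through the quotient by the closed ideal generated by `p`: it is the composition
of the quotient map with a state of the quotient. -/
def FactorsThrough (p : selfAdjoint A) (ψ : A →L[ℂ] ℂ) : Prop :=
  ∃ φ : IdealQuotient p →L[ℂ] ℂ, IsState φ ∧
    ∀ x : A, ψ x = φ (Ideal.Quotient.mk (closedIdeal p) x)

end Quotient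

/-- The element `1 - T_b T_b*`. -/
def unitaryDefect (c d : ℕ) : selfAdjoint (CStarGP.{u} c d) :=
  ⟨1 - T c d (posB c d) * star (T c d (posB c d)),
    (IsSelfAdjoint.one _).sub (IsSelfAdjoint.mul_star_self _)⟩

/-- The element `1 - ∑_{0 ≤ j < d} T_{b^j a} T_{b^j a}*`; the quotient by the closed ideal it
generates is the Cuntz algebra `𝒪(G, P)`. -/
def cuntzDefect (c d : ℕ) : selfAdjoint (CStarGP.{u} c d) :=
  ⟨1 - ∑ j ∈ Finset.range d,
      T c d (posB c d ^ j * posA c d) * star (T c d (posB c d ^ j * posA c d)),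
    (IsSelfAdjoint.one _).sub (isSelfAdjoint_sum _ fun _ _ => IsSelfAdjoint.mul_star_self _)⟩

end BaumslagSolitar

end

/-! Everything follows from one computation and one vanishing principle. The KMS condition moves
`T_x` past `T_x*` at the cost of `e^{-βθ(x)}`, and `T_x* T_x = 1`, so `ψ(T_x T_x*) = e^{-βθ(x)}`
(`IsKMS.apply_T_mul_star`). Since `θ(b) = 0` and `θ(b^j a) = 1`, `ψ` is `0` on `1 - T_b T_b*` and `1
- d e^{-β}` on the Cuntz defect. Both defects are projections fixed by the dynamics. For the Cuntz
defect this needs the ranges of the `T_{b^j a}`, `j < d`, to be orthogonal, that is, `b^i a` and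
`b^j a` to have no common upper bound (`not_exists_isUpperBound`). Positivity then gives `d ≤ e^β`.
If a KMS state kills an invariant projection `p`, then `ψ(y p z) = ψ(p z α_{iβ}(y)) = 0` by a
Cauchy-Schwarz argument, first for analytic `y`, `z` and then by density; so `ψ` kills the closed
ideal of `p` (`IsKMS.factorsThrough`). Conversely, factoring forces `ψ(p) = 0`, which for the Cuntz
defect means `e^β = d`. -/

open scoped ENNReal ComplexOrder

namespace BaumslagSolitar

/-! ### The translates `b ^ j a P` are pairwise disjoint for `0 ≤ j < d` -/

/-- For a bijection `σ` of `Fin c × Y` with `Fin d × Y`, the permutation of `ℤ × Y` that sends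
`(c q + r, y)` to `(d q + s, y')` where `(s, y') = σ (r, y)`. -/
noncomputable def digitPerm {c d : ℕ} [NeZero c] [NeZero d] {Y : Type}
    (σ : Fin c × Y ≃ Fin d × Y) : Equiv.Perm (ℤ × Y) :=
  ((Int.divModEquiv c).prodCongr (Equiv.refl Y)).trans <|
    (Equiv.prodAssoc ℤ (Fin c) Y).trans <|
      ((Equiv.refl ℤ).prodCongr σ).trans <|
        (Equiv.prodAssoc ℤ (Fin d) Y).symm.trans <|
          ((Int.divModEquiv d).prodCongr (Equiv.refl Y)).symm

theorem digitPerm_apply {c d : ℕ} [NeZero c] [NeZero d] {Y : Type}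
    (σ : Fin c × Y ≃ Fin d × Y) (q : ℤ) (r : Fin c) (y : Y) :
    digitPerm σ (q * c + (r : ℕ), y) =
      (q * d + ((σ (r, y)).1 : ℕ), (σ (r, y)).2) := by
  have h : Int.divModEquiv c (q * c + (r : ℕ)) = (q, r) :=
    (Int.divModEquiv c).apply_symm_apply (q, r)
  simp only [digitPerm, Equiv.trans_apply, Equiv.prodCongr_apply, Prod.map_apply, h]
  rfl

/-- The translation `(n, y) ↦ (n + 1, y)` of `ℤ × Y`. -/
def shiftPerm (Y : Type) : Equiv.Perm (ℤ × Y) :=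
  (Equiv.addRight (1 : ℤ)).prodCongr (Equiv.refl Y)

theorem shiftPerm_pow (Y : Type) (k : ℕ) (n : ℤ) (y : Y) :
    (shiftPerm Y ^ k) (n, y) = (n + k, y) := by
  induction k generalizing n with
  | zero => simp
  | succ k ih =>
    rw [pow_succ, Equiv.Perm.mul_apply]
    change (shiftPerm Y ^ k) (n + 1, y) = _
    rw [ih]
    push_cast
    congr 1
    ring

theorem exists_eq_mul_add {c : ℕ} [NeZero c] (n : ℤ) :
    ∃ (q : ℤ) (r : Fin c), n = q * c + (r : ℕ) :=
  ⟨(Int.divModEquiv c n).1, (Int.divModEquiv c n).2,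
    ((Int.divModEquiv c).symm_apply_apply n).symm⟩

/-- Adding `c` raises the quotient `q` by one and keeps the digit `r`, so the image moves by `d`.
This is the relation `a b^c = b^d a`, for every choice of `σ`. -/
theorem digitPerm_mul_shiftPerm_pow {c d : ℕ} [NeZero c] [NeZero d] {Y : Type}
    (σ : Fin c × Y ≃ Fin d × Y) :
    digitPerm σ * shiftPerm Y ^ c = shiftPerm Y ^ d * digitPerm σ := by
  ext1 ⟨n, y⟩
  obtain ⟨q, r, rfl⟩ := exists_eq_mul_add (c := c) n
  rw [Equiv.Perm.mul_apply, Equiv.Perm.mul_apply, shiftPerm_pow, digitPerm_apply, shiftPerm_pow,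
    show q * (c : ℤ) + (r : ℕ) + c = (q + 1) * c + (r : ℕ) by ring, digitPerm_apply]
  congr 1
  ring

/-- A bijection of `Fin c × (ℕ ⊕ ℕ)` with `Fin d × (ℕ ⊕ ℕ)` that maps `Fin c` times the left
summand into `{0}` times the left summand. -/
theorem exists_digitEquiv (c d : ℕ) [NeZero c] [NeZero d] :
    ∃ σ : Fin c × (ℕ ⊕ ℕ) ≃ Fin d × (ℕ ⊕ ℕ),
      ∀ r n, ∃ m, σ (r, Sum.inl n) = (0, Sum.inl m) := by
  let U : Set (Fin c × (ℕ ⊕ ℕ)) := {x | x.2.isLeft}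
  let V : Set (Fin d × (ℕ ⊕ ℕ)) := {x | x.1 = 0 ∧ x.2.isLeft}
  -- `U`, `V` and their complements are all countably infinite, so a bijection `U ≃ V` extends to
  -- the whole sets. The right summand is there to keep the complements infinite.
  have : Infinite U := Infinite.of_injective (fun n : ℕ => (⟨(0, Sum.inl n), rfl⟩ : U))
    fun m n h => by simpa [Subtype.ext_iff] using h
  have : Infinite V := Infinite.of_injective (fun n : ℕ => (⟨(0, Sum.inl n), rfl, rfl⟩ : V))
    fun m n h => by simpa [Subtype.ext_iff] using h
  have : Infinite (Uᶜ : Set _) :=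
    Infinite.of_injective (fun n : ℕ => (⟨(0, Sum.inr n), by simp [U]⟩ : (Uᶜ : Set _)))
      fun m n h => by simpa [Subtype.ext_iff] using h
  have : Infinite (Vᶜ : Set _) :=
    Infinite.of_injective (fun n : ℕ => (⟨(0, Sum.inr n), by simp [V]⟩ : (Vᶜ : Set _)))
      fun m n h => by simpa [Subtype.ext_iff] using h
  obtain ⟨e⟩ := nonempty_equiv_of_countable (α := U) (β := V)
  obtain ⟨e'⟩ := nonempty_equiv_of_countable (α := (Uᶜ : Set _)) (β := (Vᶜ : Set _))
  classical
  refine ⟨(Equiv.Set.sumCompl U).symm.trans ((e.sumCongr e').trans (Equiv.Set.sumCompl V)),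
    fun r n => ?_⟩
  have hU : (r, Sum.inl n) ∈ U := rfl
  obtain ⟨h1, h2⟩ := (e ⟨_, hU⟩).2
  obtain ⟨m, hm⟩ := Sum.isLeft_iff.1 h2
  refine ⟨m, ?_⟩
  simp only [Equiv.trans_apply, Equiv.Set.sumCompl_symm_apply_of_mem hU, Equiv.sumCongr_apply,
    Sum.map_inl, Equiv.Set.sumCompl_apply_inl]
  exact Prod.ext h1 hm

/-- Let the group act on `ℤ × (ℕ ⊕ ℕ)` with `b` as the shift and `a` as `digitPerm σ`. On the left
summand `a` produces only multiples of `d`, so an element of `b^l a P` sends `(0, inl 0)` to a point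
with first coordinate congruent to `l` mod `d`: a common upper bound determines `l`. The extra
factor lets `a` be invertible although it collapses digits. -/
theorem not_exists_isUpperBound {c d : ℕ} (hc : 0 < c) {i j : ℕ} (hi : i < d) (hj : j < d)
    (hij : i ≠ j) :
    ¬ ∃ z, IsUpperBound (posB c d ^ i * posA c d) (posB c d ^ j * posA c d) z := by
  rintro ⟨z, hzi, hzj⟩
  have : NeZero c := ⟨hc.ne'⟩
  have : NeZero d := ⟨(Nat.zero_lt_of_lt hi).ne'⟩
  obtain ⟨σ, hσ⟩ := exists_digitEquiv c d
  let g : Gen → Equiv.Perm (ℤ × (ℕ ⊕ ℕ))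
    | Gen.a => digitPerm σ
    | Gen.b => shiftPerm _
  have hg : ∀ r ∈ relators c d, FreeGroup.lift g r = 1 := by
    intro r hr
    rw [relators, Set.mem_singleton_iff] at hr
    subst hr
    simp only [map_mul, map_inv, map_pow, FreeGroup.lift_apply_of, g, mul_inv_eq_one]
    exact digitPerm_mul_shiftPerm_pow σ
  let f : BS c d →* Equiv.Perm (ℤ × (ℕ ⊕ ℕ)) := PresentedGroup.toGroup hg
  have fa : f (genA c d) = digitPerm σ := PresentedGroup.toGroup.of hg
  have fb : f (genB c d) = shiftPerm _ := PresentedGroup.toGroup.of hg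
  have ha : ∀ (n : ℤ) (k : ℕ), ∃ (q : ℤ) (m : ℕ),
      digitPerm σ (n, Sum.inl k) = (q * d, Sum.inl m) := by
    intro n k
    obtain ⟨q, r, rfl⟩ := exists_eq_mul_add (c := c) n
    obtain ⟨m, hm⟩ := hσ r k
    exact ⟨q, m, by simp [digitPerm_apply, hm]⟩
  -- Positivity enters here: `P` keeps the left summand invariant, by induction from the generators.
  have hP : ∀ p ∈ posMonoid c d, ∀ (n : ℤ) (k : ℕ), ∃ (n' : ℤ) (m : ℕ),
      f p (n, Sum.inl k) = (n', Sum.inl m) := by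
    intro p hp
    induction hp using Submonoid.closure_induction with
    | mem x hx =>
      intro n k
      rcases hx with rfl | rfl
      · obtain ⟨q, m, h⟩ := ha n k
        exact ⟨_, m, by rw [fa, h]⟩
      · exact ⟨n + 1, k, by rw [fb]; rfl⟩
    | one => exact fun n k => ⟨n, k, by simp⟩
    | mul x y _ _ hx hy =>
      intro n k
      obtain ⟨n', k', h⟩ := hy n k
      obtain ⟨n'', k'', h'⟩ := hx n' k'
      exact ⟨n'', k'', by rw [map_mul, Equiv.Perm.mul_apply, h, h']⟩
  have key : ∀ l : ℕ, le ((posB c d ^ l * posA c d : posMonoid c d) : BS c d) z →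
      ∃ q : ℤ, (f z (0, Sum.inl 0)).1 = q * d + l := by
    intro l hl
    obtain ⟨n', k', h⟩ := hP _ hl 0 0
    obtain ⟨q, m, h'⟩ := ha n' k'
    refine ⟨q, ?_⟩
    have hz : (z : BS c d) = genB c d ^ l * genA c d *
        (((posB c d ^ l * posA c d : posMonoid c d) : BS c d)⁻¹ * z) :=
      (mul_inv_cancel_left (genB c d ^ l * genA c d) (z : BS c d)).symm
    rw [hz, map_mul, map_mul, map_pow, fa, fb, Equiv.Perm.mul_apply, h, Equiv.Perm.mul_apply, h',
      shiftPerm_pow]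
  obtain ⟨q, hq⟩ := key i hzi
  obtain ⟨q', hq'⟩ := key j hzj
  have h : (i : ℤ) ≡ j [ZMOD d] := by
    refine Int.modEq_iff_dvd.2 ⟨q - q', ?_⟩
    linarith
  exact hij (((Int.natCast_modEq_iff).1 h).eq_of_lt_of_lt hi hj)

/-! ### Analytic elements -/

variable {c d : ℕ}

theorem IsEntireOrbit.mul {x y : CStarGP.{u} c d} {F K : ℂ → CStarGP.{u} c d}
    (hx : IsEntireOrbit x F) (hy : IsEntireOrbit y K) :
    IsEntireOrbit (x * y) (fun z => F z * K z) :=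
  ⟨hx.1.mul hy.1, fun t => by rw [map_mul, ← hx.2, ← hy.2]⟩

theorem IsEntireOrbit.add {x y : CStarGP.{u} c d} {F K : ℂ → CStarGP.{u} c d}
    (hx : IsEntireOrbit x F) (hy : IsEntireOrbit y K) :
    IsEntireOrbit (x + y) (fun z => F z + K z) :=
  ⟨hx.1.add hy.1, fun t => by rw [map_add, ← hx.2, ← hy.2]⟩

theorem isEntireOrbit_const {x : CStarGP.{u} c d} (hx : ∀ t, dynamics c d t x = x) :
    IsEntireOrbit x (fun _ => x) :=
  ⟨differentiable_const x, fun t => (hx t).symm⟩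

theorem isEntireOrbit_algebraMap (r : ℂ) :
    IsEntireOrbit (algebraMap ℂ (CStarGP.{u} c d) r) (fun _ => algebraMap ℂ _ r) :=
  isEntireOrbit_const fun t => AlgHomClass.commutes (dynamics c d t) r

theorem isEntireOrbit_T (x : posMonoid c d) :
    IsEntireOrbit (T.{u} c d x)
      (fun z => Complex.exp (Complex.I * z * height (x : BS c d)) • T c d x) := by
  refine ⟨by fun_prop, fun t => ?_⟩
  rw [dynamics, gauge_T, Circle.coe_zpow, Circle.coe_exp, ← Complex.exp_int_mul]
  ring_nf

theorem isEntireOrbit_star_T (x : posMonoid c d) :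
    IsEntireOrbit (star (T.{u} c d x))
      (fun z => Complex.exp (-(Complex.I * z * height (x : BS c d))) • star (T c d x)) := by
  refine ⟨by fun_prop, fun t => ?_⟩
  rw [map_star, ← (isEntireOrbit_T x).2 t, star_smul, Complex.star_def, ← Complex.exp_conj]
  simp

theorem dynamics_T_mul_star (t : ℝ) (x : posMonoid c d) :
    dynamics c d t (T.{u} c d x * star (T c d x)) = T c d x * star (T c d x) := by
  rw [← ((isEntireOrbit_T x).mul (isEntireOrbit_star_T x)).2 t]
  simp [smul_smul, ← Complex.exp_add]

/-- The *-algebra of the elements `x` such that `x` and `star x` are analytic. -/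
def analyticSubalgebra (c d : ℕ) : StarSubalgebra ℂ (CStarGP.{u} c d) where
  carrier := {x | (∃ F, IsEntireOrbit x F) ∧ ∃ F, IsEntireOrbit (star x) F}
  mul_mem' := by
    rintro x y ⟨⟨F, hF⟩, K, hK⟩ ⟨⟨F', hF'⟩, K', hK'⟩
    exact ⟨⟨_, hF.mul hF'⟩, _, by rw [star_mul]; exact hK'.mul hK⟩
  add_mem' := by
    rintro x y ⟨⟨F, hF⟩, K, hK⟩ ⟨⟨F', hF'⟩, K', hK'⟩
    exact ⟨⟨_, hF.add hF'⟩, _, by rw [star_add]; exact hK.add hK'⟩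
  algebraMap_mem' r :=
    ⟨⟨_, isEntireOrbit_algebraMap r⟩, _, by
      rw [← algebraMap_star_comm]; exact isEntireOrbit_algebraMap (star r)⟩
  star_mem' := by
    rintro x ⟨⟨F, hF⟩, K, hK⟩
    exact ⟨⟨K, hK⟩, F, by rwa [star_star]⟩

/-- The orbits of `T_x` and `T_x*` are scalar exponentials times a fixed element, hence entire, and
these elements generate a dense *-algebra. -/
theorem dense_analyticSubalgebra (c d : ℕ) :
    Dense (analyticSubalgebra.{u} c d : Set (CStarGP.{u} c d)) := by
  have h : StarAlgebra.adjoin ℂ (Set.range (ambientRep.{u} c d)) ≤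
      (analyticSubalgebra.{u} c d).map (universalSubalgebra.{u} c d).subtype := by
    refine StarAlgebra.adjoin_le ?_
    rintro _ ⟨x, rfl⟩
    exact ⟨T c d x, ⟨⟨_, isEntireOrbit_T x⟩, _, isEntireOrbit_star_T x⟩, rfl⟩
  rw [Subtype.dense_iff]
  exact fun x hx => closure_mono h hx

/-! ### States -/

theorem eq_zero_of_forall_add_mul_nonneg {A B : ℂ} (h : ∀ t : ℝ, 0 ≤ A + t * B) : B = 0 := by
  simp only [Complex.le_def, Complex.add_re, Complex.add_im, Complex.re_ofReal_mul,
    Complex.im_ofReal_mul, Complex.zero_re, Complex.zero_im] at h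
  have h0 := h 0
  have h1 := h 1
  have him : B.im = 0 := by linarith [h0.2, h1.2]
  refine Complex.ext ?_ him
  by_contra hne
  -- This `t` makes the real part of `A + t B` equal to `-1`.
  have h2 := (h (-(A.re + 1) / B.re)).1
  rw [div_mul_cancel₀ _ hne] at h2
  linarith

/-- A state that vanishes on a projection `p` vanishes on `p y` for all `y`. -/
theorem IsState.apply_mul_eq_zero {A : Type*} [CStarAlgebra A] {ψ : A →L[ℂ] ℂ}
    (hψ : IsState ψ) {p : A} (hp : IsStarProjection p) (h0 : ψ p = 0) (y : A) :
    ψ (p * y) = 0 := by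
  -- Positivity at `y + t w p`: the quadratic term is a multiple of `ψ(p) = 0`, so the expression is
  -- affine in real `t` and its slope vanishes. Taking `w = 1` and `w = I` separates the two
  -- unknowns.
  have key : ∀ w : ℂ, star w * ψ (p * y) + w * ψ (star y * p) = 0 := by
    intro w
    refine eq_zero_of_forall_add_mul_nonneg (A := ψ (star y * y)) fun t => ?_
    have h := hψ.nonneg (y + ((t : ℂ) * w) • p)
    have expand : star (y + ((t : ℂ) * w) • p) * (y + ((t : ℂ) * w) • p) =
        star y * y + ((t : ℂ) * w) • (star y * p) + ((t : ℂ) * star w) • (p * y) +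
          (((t : ℂ) * star w) * ((t : ℂ) * w)) • p := by
      rw [star_add, star_smul, hp.isSelfAdjoint.star_eq, star_mul', Complex.star_def,
        Complex.conj_ofReal, add_mul, mul_add, mul_add, smul_mul_smul_comm,
        hp.isIdempotentElem.eq, smul_mul_assoc, mul_smul_comm, add_assoc, add_assoc,
        add_assoc]
    rw [expand] at h
    simp only [map_add, map_smul, h0, smul_eq_mul, mul_zero, add_zero] at h
    convert h using 1
    ring
  have h1 := key 1
  have h2 := key Complex.I
  simp only [star_one, one_mul, Complex.star_def, Complex.conj_I] at h1 h2
  have h3 : Complex.I * (ψ (star y * p) - ψ (p * y)) = 0 := by linear_combination h2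
  have h4 := (mul_eq_zero.1 h3).resolve_left Complex.I_ne_zero
  linear_combination (h1 - h4) / 2

/-- A state factors through the quotient by the closed ideal generated by `p` as soon as it
vanishes on all `y p z`. -/
theorem IsState.factorsThrough {A : Type*} [CStarAlgebra A] {ψ : A →L[ℂ] ℂ}
    (hψ : IsState ψ) {p : selfAdjoint A} (h : ∀ y z : A, ψ (y * p * z) = 0) :
    FactorsThrough p ψ := by
  let J : Ideal A :=
    { carrier := {x | ∀ y z, ψ (y * x * z) = 0}
      add_mem' := fun {x x'} hx hx' y z => by
        rw [mul_add, add_mul, map_add, hx, hx', add_zero]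
      zero_mem' := by simp
      smul_mem' := fun w x hx y z => by
        rw [smul_eq_mul, ← mul_assoc]; exact hx _ _ }
  have hJ : IsClosed (J : Set A) := by
    have : (J : Set A) = ⋂ (y : A) (z : A), {x | ψ (y * x * z) = 0} := by
      ext x; simp [J]
    rw [this]
    refine isClosed_iInter fun y => isClosed_iInter fun z => isClosed_eq ?_ continuous_const
    fun_prop
  have hle : ∀ x ∈ closedIdeal p, ψ x = 0 := by
    intro x hx
    have := mem_closedIdeal.1 hx J
      ⟨fun {x} w hx y z => by rw [← mul_assoc y, mul_assoc (y * x)]; exact hx _ _⟩ hJ h 1 1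
    simpa using this
  let φ : IdealQuotient p →ₗ[ℂ] ℂ :=
    { toFun := Quotient.lift ψ fun x y hxy => by
        rw [← sub_eq_zero, ← map_sub]
        exact hle _ ((Submodule.quotientRel_def _).1 hxy)
      map_add' := fun x y => by
        obtain ⟨x, rfl⟩ := Ideal.Quotient.mk_surjective x
        obtain ⟨y, rfl⟩ := Ideal.Quotient.mk_surjective y
        exact map_add ψ x y
      map_smul' := fun r x => by
        obtain ⟨x, rfl⟩ := Ideal.Quotient.mk_surjective x
        exact map_smul ψ r x }
  refine ⟨⟨φ, ?_⟩, ⟨fun x => ?_, hψ.map_one⟩, fun x => rfl⟩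
  · exact ψ.continuous.quotient_lift _
  · obtain ⟨x, rfl⟩ := Ideal.Quotient.mk_surjective x
    exact hψ.nonneg x

theorem FactorsThrough.apply_eq_zero {A : Type*} [CStarAlgebra A] {ψ : A →L[ℂ] ℂ}
    {p : selfAdjoint A} (h : FactorsThrough p ψ) : ψ p = 0 := by
  obtain ⟨φ, -, hφ⟩ := h
  rw [hφ, Ideal.Quotient.eq_zero_iff_mem.2 (mem_closedIdeal.2 fun J _ _ hJ => hJ), map_zero]

/-! ### KMS states -/

/-- A KMS state that vanishes on an invariant projection factors through the quotient by the
closed ideal generated by the projection. -/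
theorem IsKMS.factorsThrough {β : ℝ} {ψ : CStarGP.{u} c d →L[ℂ] ℂ} (hψ : IsKMS β ψ)
    {p : selfAdjoint (CStarGP.{u} c d)} (hp : IsStarProjection (p : CStarGP.{u} c d))
    (hinv : ∀ t, dynamics c d t (p : CStarGP.{u} c d) = p) (h0 : ψ p = 0) :
    FactorsThrough p ψ := by
  refine hψ.isState.factorsThrough fun y z => ?_
  have h1 : ∀ y ∈ analyticSubalgebra.{u} c d, ∀ z ∈ analyticSubalgebra.{u} c d,
      ψ (y * p * z) = 0 := by
    rintro y ⟨⟨F, hF⟩, -⟩ z ⟨⟨K, hK⟩, -⟩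
    -- The KMS condition carries `y` to the far right, leaving `p` in front.
    rw [mul_assoc, hψ.kms y (p * z) F _ hF ((isEntireOrbit_const hinv).mul hK), mul_assoc]
    exact hψ.isState.apply_mul_eq_zero hp h0 _
  have h2 : ∀ y ∈ analyticSubalgebra.{u} c d, ∀ z, ψ (y * p * z) = 0 := fun y hy z =>
    congrFun (Continuous.ext_on (dense_analyticSubalgebra c d)
      (f := fun z => ψ (y * p * z)) (g := fun _ => 0) (by fun_prop) continuous_const
      fun z hz => h1 y hy z hz) z
  exact congrFun (Continuous.ext_on (dense_analyticSubalgebra c d)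
    (f := fun y => ψ (y * p * z)) (g := fun _ => 0) (by fun_prop) continuous_const
    fun y hy => h2 y hy z) y

theorem IsKMS.apply_T_mul_star {β : ℝ} {ψ : CStarGP.{u} c d →L[ℂ] ℂ} (hψ : IsKMS β ψ)
    (x : posMonoid c d) :
    ψ (T c d x * star (T c d x)) = Real.exp (-(β * height (x : BS c d))) := by
  rw [hψ.kms _ _ _ _ (isEntireOrbit_T x) (isEntireOrbit_star_T x), mul_smul_comm,
    (T_isNicaCovariant c d).isometry x, map_smul, hψ.isState.map_one, smul_eq_mul, mul_one,
    ← mul_assoc, Complex.I_mul_I]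
  push_cast
  ring_nf

theorem height_posB : height (posB c d : BS c d) = 0 := by
  have : heightHom c d (genB c d) = 1 := PresentedGroup.toGroup.of _
  simp [height, posB, this]

theorem height_posB_pow_mul_posA (j : ℕ) :
    height ((posB c d ^ j * posA c d : posMonoid c d) : BS c d) = 1 := by
  have hb : heightHom c d (genB c d) = 1 := PresentedGroup.toGroup.of _
  have ha : heightHom c d (genA c d) = Multiplicative.ofAdd 1 := PresentedGroup.toGroup.of _
  simp [height, posB, posA, ha, hb]

/-! ### The two defects as invariant projections, and their values under KMS states -/

theorem isStarProjection_T_mul_star (x : posMonoid c d) :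
    IsStarProjection (T.{u} c d x * star (T c d x)) where
  isSelfAdjoint := IsSelfAdjoint.mul_star_self _
  isIdempotentElem := by
    rw [IsIdempotentElem, mul_assoc, ← mul_assoc (star _), (T_isNicaCovariant c d).isometry,
      one_mul]

theorem isStarProjection_unitaryDefect (c d : ℕ) :
    IsStarProjection (unitaryDefect.{u} c d : CStarGP.{u} c d) :=
  (isStarProjection_T_mul_star _).one_sub

theorem isStarProjection_cuntzDefect (hc : 0 < c) (d : ℕ) :
    IsStarProjection (cuntzDefect.{u} c d : CStarGP.{u} c d) := by
  refine IsStarProjection.one_sub ⟨?_, isSelfAdjoint_sum _ fun _ _ => IsSelfAdjoint.mul_star_self _⟩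
  rw [IsIdempotentElem, Finset.sum_mul_sum]
  refine Finset.sum_congr rfl fun i hi => ?_
  rw [Finset.sum_eq_single_of_mem i hi]
  · exact (isStarProjection_T_mul_star _).isIdempotentElem
  -- Off-diagonal products vanish by Nica covariance, as the join is infinite.
  · intro j hj hji
    exact (T_isNicaCovariant c d).no_join _ _ (not_exists_isUpperBound hc (Finset.mem_range.1 hi)
      (Finset.mem_range.1 hj) hji.symm)

theorem dynamics_unitaryDefect (t : ℝ) :
    dynamics c d t (unitaryDefect.{u} c d : CStarGP.{u} c d) = unitaryDefect c d := by
  simp only [unitaryDefect, map_sub, map_one, dynamics_T_mul_star]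

theorem dynamics_cuntzDefect (t : ℝ) :
    dynamics c d t (cuntzDefect.{u} c d : CStarGP.{u} c d) = cuntzDefect c d := by
  simp only [cuntzDefect, map_sub, map_one, map_sum, dynamics_T_mul_star]

theorem IsKMS.apply_unitaryDefect {β : ℝ} {ψ : CStarGP.{u} c d →L[ℂ] ℂ} (hψ : IsKMS β ψ) :
    ψ (unitaryDefect c d : CStarGP.{u} c d) = 0 := by
  simp only [unitaryDefect, map_sub, hψ.isState.map_one, hψ.apply_T_mul_star, height_posB]
  simp

theorem IsKMS.apply_cuntzDefect {β : ℝ} {ψ : CStarGP.{u} c d →L[ℂ] ℂ} (hψ : IsKMS β ψ) :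
    ψ (cuntzDefect c d : CStarGP.{u} c d) = ((1 - d * Real.exp (-β) : ℝ) : ℂ) := by
  simp only [cuntzDefect, map_sub, map_sum, hψ.isState.map_one, hψ.apply_T_mul_star,
    height_posB_pow_mul_posA]
  simp

end BaumslagSolitar

theorem corollary5p3 (c d : ℕ) (hc : 0 < c) (hd : 0 < d) (β : ℝ) :
    (∀ ψ : BaumslagSolitar.CStarGP.{u} c d →L[ℂ] ℂ, BaumslagSolitar.IsKMS β ψ →
      BaumslagSolitar.FactorsThrough (BaumslagSolitar.unitaryDefect.{u} c d) ψ) ∧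
    (β < Real.log d →
      ¬ ∃ ψ : BaumslagSolitar.CStarGP.{u} c d →L[ℂ] ℂ, BaumslagSolitar.IsKMS β ψ) ∧
    (∀ ψ : BaumslagSolitar.CStarGP.{u} c d →L[ℂ] ℂ, BaumslagSolitar.IsKMS β ψ →
      (BaumslagSolitar.FactorsThrough (BaumslagSolitar.cuntzDefect.{u} c d) ψ ↔
        β = Real.log d)) := by
  open BaumslagSolitar in
  have hd' : (0 : ℝ) < d := Nat.cast_pos.2 hd
  refine ⟨fun ψ hψ => hψ.factorsThrough (isStarProjection_unitaryDefect c d)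
    dynamics_unitaryDefect hψ.apply_unitaryDefect, ?_, fun ψ hψ => ⟨fun h => ?_, fun h => ?_⟩⟩
  · rintro hβ ⟨ψ, hψ⟩
    have hp := isStarProjection_cuntzDefect.{u} hc d
    -- For a projection `p* p = p`, so this reads `0 ≤ 1 - d e^{-β}`.
    have h := hψ.isState.nonneg (cuntzDefect c d : CStarGP.{u} c d)
    rw [hp.isSelfAdjoint.star_eq, hp.isIdempotentElem.eq, hψ.apply_cuntzDefect,
      Complex.zero_le_real, Real.exp_neg, sub_nonneg, ← div_eq_mul_inv,
      div_le_one (Real.exp_pos β)] at h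
    exact absurd ((Real.log_le_iff_le_exp hd').2 h) (not_le.2 hβ)
  · have h0 := h.apply_eq_zero
    rw [hψ.apply_cuntzDefect, Complex.ofReal_eq_zero, Real.exp_neg, sub_eq_zero,
      ← div_eq_mul_inv, eq_comm, div_eq_one_iff_eq (Real.exp_pos β).ne'] at h0
    rw [h0, Real.log_exp]
  · refine hψ.factorsThrough (isStarProjection_cuntzDefect hc d) dynamics_cuntzDefect ?_
    rw [hψ.apply_cuntzDefect, h, Real.exp_neg, Real.exp_log hd', mul_inv_cancel₀ hd'.ne', sub_self,
      Complex.ofReal_zero]
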